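/- **Theorem (One-relator Artin groups).** For letters $x,y$ and $m\ge 1$ let $(x,y)_m = xyxy\cdots$ be the alternating word with $m$ letters in total that starts with $x$. Let $m>1$, let $G=\mathrm{Art}_m=\langle a,b \mid (a,b)_m=(b,a)_m\rangle$, and let $z\in G$ be the element represented by $(a,b)_m=(b,a)_m$. Words are finite words over $\{a,b,a^{-1},b^{-1}\}$, and a word is reduced if it has no subword $xx^{-1}$ or $x^{-1}x$ with $x\in\{a,b\}$; subwords are contiguous. 1. If $m\ge 3$, the center of $G$ is infinite cyclic, generated by $z$ if $m$ is even and by $z^2$ if $m$ is odd. (If $m=2$, then $G$ is abelian, so its center is all of $G$, and $z$ has infinite order.) 2. $G$ is virtually a direct product of a free group and an infinite cyclic group: it has a finite-index subgroup isomorphic to $F\times\mathbb{Z}$ for some free group $F$. 3. Every nonempty reduced word that represents the identity of $G$ contains $(a,b)_m$, $(b,a)_m$, or the inverse of one of these two words as a subword. 4. A word represents the identity of $G$ if and only if it can be transformed into the empty word by finitely many moves of the following kinds: replacing a subword $(a,b)_m$ by $(b,a)_m$ or vice versa; replacing a subword $(a,b)_m^{-1}$ by $(b,a)_m^{-1}$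 or vice versa (formal inverse words); and free reductions, i.e. deleting a subword $xx^{-1}$ or $x^{-1}x$ with $x\in\{a,b\}$ (no insertions). -/

import Mathlib

/-- Words over `{a, b, a⁻¹, b⁻¹}`, with `a = 0` and `b = 1`; the letter `(x, true)` stands for the
generator `x` and `(x, false)` for its inverse. These are the words underlying
`FreeGroup (Fin 2)`. -/
abbrev ArtWord : Type := List (Fin 2 × Bool)

/-- The positive alternating word `(x, y)_n = x y x y ⋯` with `n` letters in total. -/
def altWord (x y : Fin 2) : ℕ → ArtWord
  | 0 => []
  | n + 1 => (x, true) :: altWord y x n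

/-- The word `(a, b)_m`. -/
def abWord (m : ℕ) : ArtWord := altWord 0 1 m

/-- The word `(b, a)_m`. -/
def baWord (m : ℕ) : ArtWord := altWord 1 0 m

/-- The group `Art_m = ⟨a, b ∣ (a, b)_m = (b, a)_m⟩`. -/
abbrev Art (m : ℕ) : Type :=
  PresentedGroup ({FreeGroup.mk (abWord m) * (FreeGroup.mk (baWord m))⁻¹} :
    Set (FreeGroup (Fin 2)))

/-- The element of `Art_m` represented by a word. -/
def artEval (m : ℕ) (w : ArtWord) : Art m :=
  PresentedGroup.mk _ (FreeGroup.mk w)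

/-- One rewriting move on words: replace a subword `(a, b)_m` by `(b, a)_m` or conversely, do the
same with the inverse words, or delete a subword `x x⁻¹` or `x⁻¹ x` with `x` a generator. Free
insertions are not allowed. -/
inductive ArtMove (m : ℕ) : ArtWord → ArtWord → Prop
  | ab_ba (u v : ArtWord) : ArtMove m (u ++ abWord m ++ v) (u ++ baWord m ++ v)
  | ba_ab (u v : ArtWord) : ArtMove m (u ++ baWord m ++ v) (u ++ abWord m ++ v)
  | ab_ba_inv (u v : ArtWord) :
      ArtMove m (u ++ FreeGroup.invRev (abWord m) ++ v) (u ++ FreeGroup.invRev (baWord m) ++ v)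
  | ba_ab_inv (u v : ArtWord) :
      ArtMove m (u ++ FreeGroup.invRev (baWord m) ++ v) (u ++ FreeGroup.invRev (abWord m) ++ v)
  | cancel {w w' : ArtWord} (h : FreeGroup.Red.Step w w') : ArtMove m w w'

/-!
All four parts follow from one representation of `G = Art m` and one property of words. Let `F` be
the free group on `y_i`, `i ∈ ℤ/m`, let `τ` be the automorphism `y_i ↦ y_{i + 1}` of `F`, and let
`δ` be the involution `x ↦ y_0 * x'` of the set `F`, where `x'` arises from `x` by replacing each
`y_i` by its inverse. These are affine transformations of `F`, elements of `F ⋊ (ℤ/m × {±1})`;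
they generate a copy of the free product `ℤ/m * ℤ/2`. As `τ ^ m = 1`, the assignment `a ↦ τ δ`, `b
↦ δ τ` respects the relation of `G`, for `m` of either parity: it sends `z` to `1` if `m` is even
and to `δ` if `m` is odd.

An alternating word with `n` letters of one sign becomes `τ ^ n` or `τ ^ (-n)`, up to factors `δ`
at the ends, and where two maximal alternating runs of a reduced word meet exactly one factor `δ`
remains. If all runs are shorter than `m`, the image of a nonempty word is therefore an
alternating product of `δ` and nontrivial powers of `τ`. It moves `1` or `y_0` to an element
`y_{i₁} y_{i₂}⁻¹ y_{i₃} ⋯` of `F` in which consecutive indices are distinct, which is a reduced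
word and does not lie in `{1, y_0}` (`exists_affAct_notMem`). In particular, a nonempty reduced
word without alternating subwords of length `m` does not represent `1`.

For the word problem, a nonempty reduced word that represents `1` thus contains an alternating
word of length `m`, and since its exponent sum is `0` also a letter of the opposite sign. The
moves carry the alternating word across letters of its own sign until it cancels a letter of the
other sign, so that the word becomes shorter (`reflTransGen_nil_of_artEval_eq_one`).

Since `z` normalizes the set of generators, each element of `G` is `z ^ j` times the value of a
reduced word without alternating subwords of length `m`. Since a nonempty such word moves `{1,
y_0}`, while `z` preserves this set, an element that fixes `1` and `y_0` is a power of `c`, where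
`c = z` or `c = z ^ 2` by the parity of `m` (`mem_zpowers_centerGen`). A central element commutes
with the images `τ ^ 2` of `ab` and `δ τ ^ 2 δ` of `ba`, whose only fixed points are `1` and `y_0`
if `m > 2`; so it fixes both points, and the center is generated by `c`.

Finally, the elements that act on `F` by left translations form a subgroup of finite index, which
maps to `F` with kernel generated by `c`. The image is free by the Nielsen–Schreier theorem, so
the central extension splits (`nonempty_mulEquiv_freeGroup_prod`).
-/

/-! ### Signed alternating words -/

/-- The alternating word with `n` letters that starts with the generator `x` and all of whose
letters have the sign `s`. For `n = m` these are the four words `(a, b)_m`, `(b, a)_m` and their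
inverses. -/
def altSgn (s : Bool) (x : Fin 2) : ℕ → ArtWord
  | 0 => []
  | n + 1 => (x, s) :: altSgn s (x + 1) n

/-- The generator at position `n` of an alternating word that starts with `x`; equivalently, the
`n`-th power of the swap of the two generators. -/
def swapPow (n : ℕ) (x : Fin 2) : Fin 2 := if Even n then x else x + 1

lemma add_one_add_one (x : Fin 2) : x + 1 + 1 = x := by fin_cases x <;> rfl

lemma eq_or_eq_add_one (x y : Fin 2) : y = x ∨ y = x + 1 := by
  fin_cases x <;> fin_cases y <;> simp

lemma swapPow_succ (n : ℕ) (x : Fin 2) : swapPow (n + 1) x = swapPow n x + 1 := by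
  unfold swapPow
  by_cases h : Even n <;> simp [h, Nat.even_add_one, add_one_add_one]

lemma swapPow_add_one (n : ℕ) (x : Fin 2) : swapPow n (x + 1) = swapPow n x + 1 := by
  unfold swapPow
  by_cases h : Even n <;> simp [h]

lemma swapPow_swapPow (n : ℕ) (x : Fin 2) : swapPow n (swapPow n x) = x := by
  unfold swapPow
  by_cases h : Even n <;> simp [h, add_one_add_one]

lemma length_altSgn (s : Bool) (x : Fin 2) (n : ℕ) : (altSgn s x n).length = n := by
  induction n generalizing x with
  | zero => rfl
  | succ n ih => simp [altSgn, ih]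

lemma altSgn_succ_right (s : Bool) (x : Fin 2) (n : ℕ) :
    altSgn s x (n + 1) = altSgn s x n ++ [(swapPow n x, s)] := by
  induction n generalizing x with
  | zero => simp [altSgn, swapPow]
  | succ n ih =>
    rw [altSgn, ih (x + 1), altSgn, swapPow_succ, swapPow_add_one]
    rfl

lemma not_mem_altSgn (s : Bool) (x y : Fin 2) (n : ℕ) : (y, !s) ∉ altSgn s x n := by
  induction n generalizing x with
  | zero => simp [altSgn]
  | succ n ih => simp [altSgn, ih]

lemma altWord_eq_altSgn (x : Fin 2) (n : ℕ) : altWord x (x + 1) n = altSgn true x n := by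
  induction n generalizing x with
  | zero => rfl
  | succ n ih =>
    have h := ih (x + 1)
    rw [add_one_add_one] at h
    rw [altWord, altSgn, h]

lemma abWord_eq (m : ℕ) : abWord m = altSgn true 0 m := altWord_eq_altSgn 0 m

lemma baWord_eq (m : ℕ) : baWord m = altSgn true 1 m := altWord_eq_altSgn 1 m

lemma invRev_altSgn (s : Bool) (x : Fin 2) (n : ℕ) :
    FreeGroup.invRev (altSgn s x n) = altSgn (!s) (swapPow n x + 1) n := by
  induction n generalizing x with
  | zero => rfl
  | succ n ih =>
    rw [altSgn, FreeGroup.invRev_cons, ih, altSgn_succ_right, swapPow_succ, swapPow_add_one,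
      add_one_add_one, swapPow_swapPow]
    rfl

/-- A word contains `(a, b)_m`, `(b, a)_m` or the inverse of one of them. -/
def HasAltSubword (m : ℕ) (w : ArtWord) : Prop := ∃ s x, altSgn s x m <:+: w

lemma HasAltSubword.cases {m : ℕ} {w : ArtWord} (h : HasAltSubword m w) :
    abWord m <:+: w ∨ baWord m <:+: w ∨
      FreeGroup.invRev (abWord m) <:+: w ∨ FreeGroup.invRev (baWord m) <:+: w := by
  obtain ⟨s, x, h⟩ := h
  rw [abWord_eq, baWord_eq, invRev_altSgn, invRev_altSgn]
  cases s with
  | true => fin_cases x <;> simp_all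
  | false =>
    unfold swapPow
    rw [Bool.not_true]
    split_ifs <;> fin_cases x <;> first | exact .inr (.inr (.inl h)) | exact .inr (.inr (.inr h))

/-! ### Moves -/

lemma artMove_altSgn (m : ℕ) (s : Bool) (x : Fin 2) (u v : ArtWord) :
    ArtMove m (u ++ altSgn s x m ++ v) (u ++ altSgn s (x + 1) m ++ v) := by
  have h1 := ArtMove.ab_ba (m := m) u v
  have h2 := ArtMove.ba_ab (m := m) u v
  have h3 := ArtMove.ab_ba_inv (m := m) u v
  have h4 := ArtMove.ba_ab_inv (m := m) u v
  rw [abWord_eq, baWord_eq] at h1 h2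
  rw [abWord_eq, baWord_eq, invRev_altSgn, invRev_altSgn] at h3 h4
  cases s with
  | true =>
    fin_cases x
    · exact h1
    · exact h2
  | false =>
    unfold swapPow at h3 h4
    by_cases hm : Even m <;> simp only [hm, if_true, if_false] at h3 h4 <;> fin_cases x <;>
      first | exact h3 | exact h4

lemma reflTransGen_altSgn (m : ℕ) (s : Bool) (x y : Fin 2) (u v : ArtWord) :
    Relation.ReflTransGen (ArtMove m) (u ++ altSgn s x m ++ v) (u ++ altSgn s y m ++ v) := by
  rcases eq_or_eq_add_one x y with rfl | rfl
  · exact .refl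
  · exact .single (artMove_altSgn m s x u v)

lemma artMove_cancel (m : ℕ) (s : Bool) (y : Fin 2) (u v : ArtWord) :
    ArtMove m (u ++ (y, s) :: (y, !s) :: v) (u ++ v) :=
  .cancel FreeGroup.Red.Step.not

/-- An alternating subword of length `m` is moved to the right across the letters of its own sign,
which it swaps, until it meets a letter of the opposite sign and absorbs it. -/
lemma exists_shorter_of_mem_right {m : ℕ} (hm : m ≠ 0) (s : Bool) (y : Fin 2) (v : ArtWord) :
    ∀ (u : ArtWord) (x : Fin 2), (y, !s) ∈ v → ∃ w,
      Relation.ReflTransGen (ArtMove m) (u ++ altSgn s x m ++ v) w ∧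
        w.length < (u ++ altSgn s x m ++ v).length := by
  obtain ⟨k, rfl⟩ := Nat.exists_eq_succ_of_ne_zero hm
  induction v with
  | nil => simp
  | cons c v ih =>
    intro u x hy
    obtain ⟨c, t⟩ := c
    by_cases ht : t = s
    · subst ht
      have hy' : (y, !t) ∈ v := by simpa using hy
      obtain ⟨w, hw, hl⟩ := ih (u ++ [(swapPow (k + 1) c, t)]) (swapPow (k + 1) c + 1) hy'
      refine ⟨w, (reflTransGen_altSgn _ t x (swapPow (k + 1) c) u _).trans ?_, ?_⟩
      · have h1 : altSgn t (swapPow (k + 1) c) (k + 1) ++ [(c, t)]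
            = (swapPow (k + 1) c, t) :: altSgn t (swapPow (k + 1) c + 1) (k + 1) := by
          have h2 := altSgn_succ_right t (swapPow (k + 1) c) (k + 1)
          rw [swapPow_swapPow] at h2
          exact h2.symm
        have h3 : u ++ altSgn t (swapPow (k + 1) c) (k + 1) ++ (c, t) :: v
            = u ++ [(swapPow (k + 1) c, t)] ++ altSgn t (swapPow (k + 1) c + 1) (k + 1) ++ v := by
          rw [List.append_cons, List.append_assoc u, h1]
          simp
        rw [Nat.succ_eq_add_one, h3]
        exact hw
      · simp only [List.length_append, List.length_cons, length_altSgn] at hl ⊢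
        simp at hl
        omega
    · obtain rfl : t = !s := by cases t <;> cases s <;> simp_all
      refine ⟨u ++ altSgn s (swapPow k c) k ++ v,
        (reflTransGen_altSgn _ s x (swapPow k c) u _).tail ?_, ?_⟩
      · rw [altSgn_succ_right, swapPow_swapPow]
        simpa using artMove_cancel (k + 1) s c (u ++ altSgn s (swapPow k c) k) v
      · simp [length_altSgn]
        omega

lemma exists_shorter_of_mem_left {m : ℕ} (hm : m ≠ 0) (s : Bool) (y : Fin 2) (u : ArtWord) :
    ∀ (v : ArtWord) (x : Fin 2), (y, !s) ∈ u → ∃ w,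
      Relation.ReflTransGen (ArtMove m) (u ++ altSgn s x m ++ v) w ∧
        w.length < (u ++ altSgn s x m ++ v).length := by
  obtain ⟨k, rfl⟩ := Nat.exists_eq_succ_of_ne_zero hm
  induction u using List.reverseRecOn with
  | nil => simp
  | append_singleton u c ih =>
    intro v x hy
    obtain ⟨c, t⟩ := c
    by_cases ht : t = s
    · subst ht
      have hy' : (y, !t) ∈ u := by simpa using hy
      obtain ⟨w, hw, hl⟩ := ih ((swapPow (k + 1) c, t) :: v) c hy'
      refine ⟨w, (reflTransGen_altSgn _ t x (c + 1) _ _).trans ?_, ?_⟩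
      · have h1 : (c, t) :: altSgn t (c + 1) (k + 1)
            = altSgn t c (k + 1) ++ [(swapPow (k + 1) c, t)] := altSgn_succ_right t c (k + 1)
        have h3 : u ++ [(c, t)] ++ altSgn t (c + 1) (k + 1) ++ v
            = u ++ altSgn t c (k + 1) ++ (swapPow (k + 1) c, t) :: v := by
          rw [List.append_assoc u, List.singleton_append, h1]
          simp
        rw [Nat.succ_eq_add_one, h3]
        exact hw
      · simp only [List.length_append, List.length_cons, length_altSgn, List.length_nil] at hl ⊢
        omega
    · obtain rfl : t = !s := by cases t <;> cases s <;> simp_all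
      refine ⟨u ++ altSgn s (c + 1) k ++ v, (reflTransGen_altSgn _ s x c _ _).tail ?_, ?_⟩
      · have h := artMove_cancel (k + 1) (!s) c u (altSgn s (c + 1) k ++ v)
        rw [Bool.not_not] at h
        simpa [altSgn] using h
      · simp [length_altSgn]

/-! ### Evaluation of words -/

lemma artEval_nil (m : ℕ) : artEval m [] = 1 := rfl

lemma artEval_append (m : ℕ) (u v : ArtWord) :
    artEval m (u ++ v) = artEval m u * artEval m v := by
  rw [artEval, ← FreeGroup.mul_mk, map_mul]
  rfl

lemma artEval_cons (m : ℕ) (c : Fin 2 × Bool) (w : ArtWord) :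
    artEval m (c :: w) = artEval m [c] * artEval m w := artEval_append m [c] w

lemma artEval_invRev (m : ℕ) (w : ArtWord) :
    artEval m (FreeGroup.invRev w) = (artEval m w)⁻¹ := by
  rw [artEval, ← FreeGroup.inv_mk, map_inv]
  rfl

lemma artEval_not (m : ℕ) (x : Fin 2) (s : Bool) :
    artEval m [(x, !s)] = (artEval m [(x, s)])⁻¹ := artEval_invRev m [(x, s)]

lemma artEval_surjective (m : ℕ) : Function.Surjective (artEval m) := by
  intro g
  obtain ⟨f, rfl⟩ := PresentedGroup.mk_surjective _ g
  exact ⟨f.toWord, by rw [artEval, FreeGroup.mk_toWord]⟩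

lemma artEval_baWord (m : ℕ) : artEval m (baWord m) = artEval m (abWord m) :=
  (PresentedGroup.mk_eq_mk_of_mul_inv_mem (by simp)).symm

lemma artEval_altSgn_true (m : ℕ) (x : Fin 2) :
    artEval m (altSgn true x m) = artEval m (abWord m) := by
  fin_cases x
  · exact congrArg _ (abWord_eq m).symm
  · exact (congrArg _ (baWord_eq m).symm).trans (artEval_baWord m)

lemma artEval_altSgn_false (m : ℕ) (x : Fin 2) :
    artEval m (altSgn false x m) = (artEval m (abWord m))⁻¹ := by
  rw [← artEval_altSgn_true m (swapPow m x + 1), ← artEval_invRev, invRev_altSgn,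
    swapPow_add_one, swapPow_swapPow, add_one_add_one]
  rfl

lemma artEval_red {m : ℕ} {w w' : ArtWord} (h : FreeGroup.Red w w') :
    artEval m w = artEval m w' :=
  congrArg (PresentedGroup.mk _) (FreeGroup.Red.exact.2 ⟨w', h, .refl⟩)

lemma ArtMove.artEval_eq {m : ℕ} {w w' : ArtWord} (h : ArtMove m w w') :
    artEval m w = artEval m w' := by
  cases h with
  | cancel h => exact artEval_red h.to_red
  | _ => simp only [artEval_append, artEval_invRev, artEval_baWord]

lemma artEval_eq_of_reflTransGen {m : ℕ} {w w' : ArtWord}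
    (h : Relation.ReflTransGen (ArtMove m) w w') : artEval m w = artEval m w' := by
  induction h with
  | refl => rfl
  | tail _ h ih => exact ih.trans h.artEval_eq

/-- Conjugation by `z` is the `m`-th power of the swap of the generators. -/
lemma z_mul_letter (m : ℕ) (x : Fin 2) (s : Bool) :
    artEval m (abWord m) * artEval m [(x, s)]
      = artEval m [(swapPow m x, s)] * artEval m (abWord m) := by
  have key : artEval m (abWord m) * artEval m [(x, true)]
      = artEval m [(swapPow m x, true)] * artEval m (abWord m) := by
    have h := altSgn_succ_right true (swapPow m x) m
    rw [swapPow_swapPow, altSgn] at h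
    have h' := congrArg (artEval m) h
    rw [artEval_append, artEval_cons, artEval_altSgn_true, artEval_altSgn_true] at h'
    exact h'.symm
  cases s with
  | true => exact key
  | false =>
    rw [show false = !true from rfl, artEval_not, artEval_not, ← mul_inv_eq_iff_eq_mul, mul_assoc,
      eq_comm, inv_eq_iff_eq_inv]
    simp only [mul_inv_rev, inv_inv]
    rw [eq_mul_inv_iff_mul_eq, ← key]

lemma exists_z_mul (m : ℕ) (u : ArtWord) :
    ∃ u' : ArtWord, u'.length = u.length ∧
      artEval m (abWord m) * artEval m u = artEval m u' * artEval m (abWord m) := by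
  induction u with
  | nil => exact ⟨[], rfl, by simp [artEval_nil]⟩
  | cons c u ih =>
    obtain ⟨u', hl, h⟩ := ih
    refine ⟨(swapPow m c.1, c.2) :: u', by simp [hl], ?_⟩
    rw [artEval_cons, artEval_cons m _ u', ← mul_assoc, z_mul_letter, mul_assoc, h, mul_assoc]

lemma exists_mul_z (m : ℕ) (u : ArtWord) :
    ∃ u' : ArtWord, u'.length = u.length ∧
      artEval m u * artEval m (abWord m) = artEval m (abWord m) * artEval m u' := by
  induction u with
  | nil => exact ⟨[], rfl, by simp [artEval_nil]⟩
  | cons c u ih =>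
    obtain ⟨u', hl, h⟩ := ih
    refine ⟨(swapPow m c.1, c.2) :: u', by simp [hl], ?_⟩
    rw [artEval_cons, artEval_cons m _ u', mul_assoc, h, ← mul_assoc, ← mul_assoc, z_mul_letter,
      swapPow_swapPow]

/-- An element that commutes with both generators is central. -/
lemma mem_center_of_letters {m : ℕ} {g : Art m}
    (h : ∀ x, g * artEval m [(x, true)] = artEval m [(x, true)] * g) :
    g ∈ Subgroup.center (Art m) := by
  rw [Subgroup.mem_center_iff]
  intro k
  have hk : k ∈ Subgroup.centralizer {g} := by
    refine PresentedGroup.generated_by _ _ (fun x => ?_) k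
    rw [Subgroup.mem_centralizer_singleton_iff]
    exact (h x).symm
  exact Subgroup.mem_centralizer_singleton_iff.1 hk

lemma z_mem_center {m : ℕ} (hm : Even m) : artEval m (abWord m) ∈ Subgroup.center (Art m) :=
  mem_center_of_letters fun x => by rw [z_mul_letter, swapPow, if_pos hm]

lemma z_sq_mem_center (m : ℕ) : artEval m (abWord m) ^ 2 ∈ Subgroup.center (Art m) :=
  mem_center_of_letters fun x => by
    rw [sq, mul_assoc, z_mul_letter, ← mul_assoc, z_mul_letter, swapPow_swapPow, mul_assoc]

lemma center_eq_top : Subgroup.center (Art 2) = ⊤ := by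
  have key : ∀ x y : Fin 2, artEval 2 [(x, true)] * artEval 2 [(y, true)]
      = artEval 2 [(y, true)] * artEval 2 [(x, true)] := by
    have h : artEval 2 [(0, true)] * artEval 2 [(1, true)]
        = artEval 2 [(1, true)] * artEval 2 [(0, true)] := by
      rw [← artEval_append, ← artEval_append]
      exact (artEval_baWord 2).symm
    intro x y
    fin_cases x <;> fin_cases y
    · rfl
    · exact h
    · exact h.symm
    · rfl
  rw [eq_top_iff]
  intro g _
  exact PresentedGroup.generated_by _ _ (fun x => mem_center_of_letters (key x)) g

/-- The exponent sum. -/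
def expSum (m : ℕ) : Art m →* Multiplicative ℤ :=
  PresentedGroup.toGroup (f := fun _ => Multiplicative.ofAdd 1) (by
    have h : ∀ (x : Fin 2) (n : ℕ), FreeGroup.lift (fun _ : Fin 2 => Multiplicative.ofAdd (1 : ℤ))
        (FreeGroup.mk (altSgn true x n)) = Multiplicative.ofAdd (1 : ℤ) ^ n := by
      intro x n
      induction n generalizing x with
      | zero => rfl
      | succ n ih =>
        rw [altSgn, ← List.singleton_append, ← FreeGroup.mul_mk, map_mul, ih, pow_succ']
        rfl
    intro r hr
    rw [Set.mem_singleton_iff.1 hr, abWord_eq, baWord_eq, map_mul, map_inv, h, h, mul_inv_cancel])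

lemma expSum_letter (m : ℕ) (x : Fin 2) (s : Bool) :
    (expSum m (artEval m [(x, s)])).toAdd = if s then 1 else -1 := by
  have h : expSum m (artEval m [(x, true)]) = Multiplicative.ofAdd 1 := PresentedGroup.toGroup.of _
  cases s with
  | true => rw [h]; rfl
  | false => rw [show false = !true from rfl, artEval_not, map_inv, h]; rfl

lemma expSum_of_forall_sign (m : ℕ) (s : Bool) (w : ArtWord) (hw : ∀ y, (y, !s) ∉ w) :
    (expSum m (artEval m w)).toAdd = (if s then 1 else -1) * (w.length : ℤ) := by
  induction w with
  | nil => simp [artEval_nil]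
  | cons c w ih =>
    obtain ⟨c, t⟩ := c
    obtain rfl : t = s := by
      by_contra h
      apply hw c
      cases t <;> cases s <;> simp_all
    rw [artEval_cons, map_mul, toAdd_mul, expSum_letter, ih fun y hy => hw y (by simp [hy])]
    cases t
    all_goals simp
    all_goals ring

lemma z_not_isOfFinOrder {m : ℕ} (hm : m ≠ 0) : ¬ IsOfFinOrder (artEval m (abWord m)) := by
  rw [isOfFinOrder_iff_pow_eq_one]
  rintro ⟨n, hn, h⟩
  have h1 := congrArg (fun g => (expSum m g).toAdd) h
  have h2 : (expSum m (artEval m (abWord m))).toAdd = m := by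
    rw [← artEval_altSgn_true m 0,
      expSum_of_forall_sign m true _ fun y => not_mem_altSgn true 0 y m, length_altSgn]
    simp
  simp only [map_pow, toAdd_pow, map_one, toAdd_one, h2, nsmul_eq_mul, mul_eq_zero,
    Nat.cast_eq_zero] at h1
  omega

/-- Every element is a power of `z` times a reduced word without alternating subwords of
length `m`: pulling such a subword out to the left shortens the word. -/
lemma exists_zpow_mul_artEval {m : ℕ} (hm : m ≠ 0) (g : Art m) :
    ∃ (j : ℤ) (w : ArtWord), FreeGroup.IsReduced w ∧ ¬ HasAltSubword m w ∧
      g = artEval m (abWord m) ^ j * artEval m w := by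
  obtain ⟨w, rfl⟩ := artEval_surjective m g
  induction hn : w.length using Nat.strong_induction_on generalizing w with
  | _ n ih =>
    subst hn
    by_cases hr : FreeGroup.IsReduced w
    · by_cases hd : HasAltSubword m w
      · obtain ⟨s, x, u, v, rfl⟩ := hd
        cases s with
        | true =>
          obtain ⟨u', hl, hu⟩ := exists_mul_z m u
          obtain ⟨j, w, h1, h2, h3⟩ := ih (u' ++ v).length
            (by simp only [List.length_append, length_altSgn, hl]; omega) (u' ++ v) rfl
          refine ⟨1 + j, w, h1, h2, ?_⟩
          rw [zpow_add, mul_assoc, ← h3, artEval_append, artEval_append, artEval_altSgn_true, hu,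
            artEval_append, zpow_one, mul_assoc]
        | false =>
          obtain ⟨u', hl, hu⟩ := exists_z_mul m u
          obtain ⟨j, w, h1, h2, h3⟩ := ih (u' ++ v).length
            (by simp only [List.length_append, length_altSgn, hl]; omega) (u' ++ v) rfl
          refine ⟨-1 + j, w, h1, h2, ?_⟩
          rw [zpow_add, mul_assoc, ← h3, artEval_append, artEval_append, artEval_altSgn_false,
            artEval_append, zpow_neg_one, ← mul_assoc, eq_inv_mul_of_mul_eq (by
              rw [← mul_assoc, hu, mul_inv_cancel_right] :
                artEval m (abWord m) * (artEval m u * (artEval m (abWord m))⁻¹) = artEval m u')]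
      · exact ⟨0, w, hr, hd, by simp⟩
    · rw [FreeGroup.isReduced_iff_not_step] at hr
      push Not at hr
      obtain ⟨w', hw'⟩ := hr
      rw [artEval_red hw'.to_red]
      exact ih _ (by have := hw'.length; omega) w' rfl

/-- The word problem, granted that a nonempty reduced word which represents `1` has an alternating
subword of length `m`. -/
lemma reflTransGen_nil_of_artEval_eq_one {m : ℕ} (hm : m ≠ 0)
    (key : ∀ w : ArtWord, FreeGroup.IsReduced w → w ≠ [] → artEval m w = 1 → HasAltSubword m w)
    (w : ArtWord) (hw : artEval m w = 1) : Relation.ReflTransGen (ArtMove m) w [] := by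
  induction hn : w.length using Nat.strong_induction_on generalizing w with
  | _ n ih =>
    subst hn
    suffices h : w = [] ∨ ∃ w', Relation.ReflTransGen (ArtMove m) w w' ∧ w'.length < w.length by
      rcases h with rfl | ⟨w', h, hl⟩
      · exact .refl
      · exact h.trans (ih _ hl w' ((artEval_eq_of_reflTransGen h).symm.trans hw) rfl)
    by_cases hr : FreeGroup.IsReduced w
    · refine or_iff_not_imp_left.2 fun hne => ?_
      obtain ⟨s, x, u, v, rfl⟩ := key w hr hne hw
      -- the exponent sum vanishes, so there is a letter of sign opposite to `s`
      obtain ⟨y, hy⟩ : ∃ y, (y, !s) ∈ u ++ altSgn s x m ++ v := by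
        by_contra! h
        have h1 := expSum_of_forall_sign m s _ h
        rw [hw, map_one, toAdd_one] at h1
        simp only [List.length_append, length_altSgn] at h1
        cases s <;> simp at h1 <;> omega
      simp only [List.mem_append, not_mem_altSgn, or_false] at hy
      rcases hy with hy | hy
      · exact exists_shorter_of_mem_left hm s y u v x hy
      · exact exists_shorter_of_mem_right hm s y v u x hy
    · rw [FreeGroup.isReduced_iff_not_step] at hr
      push Not at hr
      obtain ⟨w', hw'⟩ := hr
      exact .inr ⟨w', .single (.cancel hw'), by have := hw'.length; omega⟩

/-! ### The semidirect product -/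

/-- The group `ℤ/m × {±1}` of symmetries of the free group on `ℤ/m`. -/
abbrev TwistGroup (m : ℕ) : Type := Multiplicative (ZMod m) × ℤˣ

/-- `(i, e)` sends the generator `y_j` of the free group to `y_{j + i}` raised to the power `e`. -/
def twistHom (m : ℕ) (q : TwistGroup m) : FreeGroup (ZMod m) →* FreeGroup (ZMod m) :=
  FreeGroup.lift fun j => FreeGroup.of (j + q.1.toAdd) ^ (q.2 : ℤ)

lemma twistHom_of (m : ℕ) (q : TwistGroup m) (j : ZMod m) :
    twistHom m q (FreeGroup.of j) = FreeGroup.of (j + q.1.toAdd) ^ (q.2 : ℤ) :=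
  FreeGroup.lift_apply_of

lemma twistHom_mul (m : ℕ) (p q : TwistGroup m) :
    twistHom m (p * q) = (twistHom m p).comp (twistHom m q) := by
  ext j
  rw [MonoidHom.comp_apply, twistHom_of, twistHom_of, map_zpow, twistHom_of, ← zpow_mul,
    Prod.fst_mul, Prod.snd_mul, toAdd_mul, Units.val_mul, add_assoc, add_comm p.1.toAdd]

lemma twistHom_one (m : ℕ) : twistHom m 1 = MonoidHom.id _ := by
  ext j
  simp [twistHom_of]

/-- The action of `ℤ/m × {±1}` on the free group on `ℤ/m`. -/
def twist (m : ℕ) : TwistGroup m →* MulAut (FreeGroup (ZMod m)) where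
  toFun q := MonoidHom.toMulEquiv (twistHom m q) (twistHom m q⁻¹)
    (by rw [← twistHom_mul, inv_mul_cancel, twistHom_one])
    (by rw [← twistHom_mul, mul_inv_cancel, twistHom_one])
  map_one' := by ext1 x; exact DFunLike.congr_fun (twistHom_one m) x
  map_mul' p q := by ext1 x; exact DFunLike.congr_fun (twistHom_mul m p q) x

lemma twist_of (m : ℕ) (q : TwistGroup m) (j : ZMod m) :
    twist m q (FreeGroup.of j) = FreeGroup.of (j + q.1.toAdd) ^ (q.2 : ℤ) := twistHom_of m q j

/-- The group of affine transformations `x ↦ f * q x` of the free group on `ℤ/m`. -/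
abbrev AffGroup (m : ℕ) : Type := FreeGroup (ZMod m) ⋊[twist m] TwistGroup m

/-- The action of an affine transformation on the free group. -/
def affAct {m : ℕ} (p : AffGroup m) (x : FreeGroup (ZMod m)) : FreeGroup (ZMod m) :=
  p.left * twist m p.right x

lemma affAct_mul {m : ℕ} (p q : AffGroup m) (x : FreeGroup (ZMod m)) :
    affAct (p * q) x = affAct p (affAct q x) := by
  simp [affAct, mul_assoc]

lemma affAct_one {m : ℕ} (x : FreeGroup (ZMod m)) : affAct (1 : AffGroup m) x = x := by
  simp [affAct]

/-- The rotation `y_j ↦ y_{j + i}`. -/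
def rot (m : ℕ) (i : ZMod m) : AffGroup m := SemidirectProduct.inr (Multiplicative.ofAdd i, 1)

/-- The involution `x ↦ y_0 * x'`, where `x'` arises from `x` by inverting the generators. -/
def flip₀ (m : ℕ) : AffGroup m := ⟨FreeGroup.of 0, (1, -1)⟩

lemma rot_add (m : ℕ) (i j : ZMod m) : rot m (i + j) = rot m i * rot m j := by
  rw [rot, rot, rot, ← map_mul]
  simp

lemma rot_zero (m : ℕ) : rot m 0 = 1 := map_one SemidirectProduct.inr

lemma rot_neg (m : ℕ) (i : ZMod m) : rot m (-i) = (rot m i)⁻¹ :=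
  eq_inv_of_mul_eq_one_left (by rw [← rot_add, neg_add_cancel, rot_zero])

lemma flip₀_mul_self (m : ℕ) : flip₀ m * flip₀ m = 1 := by
  ext
  · simp [flip₀, twist_of]
  · simp [flip₀]
  · simp [flip₀]

lemma flip₀_mul_flip₀_mul (m : ℕ) (p : AffGroup m) : flip₀ m * (flip₀ m * p) = p := by
  rw [← mul_assoc, flip₀_mul_self, one_mul]

lemma flip₀_inv (m : ℕ) : (flip₀ m)⁻¹ = flip₀ m :=
  inv_eq_of_mul_eq_one_left (flip₀_mul_self m)

/-- The images `τδ` of `a` and `δτ` of `b`, for `τ` the rotation by `1` and `δ` the involution. -/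
def affGen (m : ℕ) (x : Fin 2) : AffGroup m :=
  if x = 0 then rot m 1 * flip₀ m else flip₀ m * rot m 1

lemma lift_altSgn (m n : ℕ) :
    FreeGroup.lift (affGen m) (FreeGroup.mk (altSgn true 0 n))
        = rot m n * (if Even n then 1 else flip₀ m) ∧
      FreeGroup.lift (affGen m) (FreeGroup.mk (altSgn true 1 n))
        = flip₀ m * rot m n * (if Even n then flip₀ m else 1) := by
  have hc : ∀ (x : Fin 2) (n : ℕ), FreeGroup.lift (affGen m) (FreeGroup.mk (altSgn true x (n + 1)))
      = affGen m x * FreeGroup.lift (affGen m) (FreeGroup.mk (altSgn true (x + 1) n)) := by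
    intro x n
    rw [altSgn, ← List.singleton_append, ← FreeGroup.mul_mk, map_mul]
    congr 1
    exact FreeGroup.lift_apply_of
  induction n with
  | zero =>
    have h : FreeGroup.lift (affGen m) (FreeGroup.mk []) = 1 := map_one _
    simp [altSgn, h, rot_zero, flip₀_mul_self]
  | succ n ih =>
    rw [hc, hc, zero_add, show (1 : Fin 2) + 1 = 0 from rfl, ih.1, ih.2, Nat.cast_add_one,
      add_comm (n : ZMod m), rot_add]
    by_cases hn : Even n <;>
      simp [hn, Nat.even_add_one, affGen, mul_assoc, flip₀_mul_flip₀_mul]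

/-- The representation of `Art m` by affine transformations of the free group. -/
def toAff (m : ℕ) : Art m →* AffGroup m :=
  PresentedGroup.toGroup (f := affGen m) (by
    intro r hr
    rw [Set.mem_singleton_iff.1 hr, abWord_eq, baWord_eq, map_mul, map_inv, (lift_altSgn m m).1,
      (lift_altSgn m m).2, ZMod.natCast_self, rot_zero]
    by_cases hm : Even m <;> simp [hm, flip₀_mul_self])

lemma toAff_artEval (m : ℕ) (w : ArtWord) :
    toAff m (artEval m w) = FreeGroup.lift (affGen m) (FreeGroup.mk w) := rfl

lemma toAff_letter_true (m : ℕ) (x : Fin 2) : toAff m (artEval m [(x, true)]) = affGen m x :=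
  PresentedGroup.toGroup.of _

lemma toAff_z (m : ℕ) :
    toAff m (artEval m (abWord m)) = if Even m then 1 else flip₀ m := by
  rw [← artEval_altSgn_true m 0, toAff_artEval, (lift_altSgn m m).1, ZMod.natCast_self, rot_zero,
    one_mul]

/-- The exponent of a letter of sign `s`. -/
def sgn (m : ℕ) (s : Bool) : ZMod m := if s then 1 else -1

/-- Whether the image of a letter in the affine group starts with the involution. -/
def flipsFirst (x : Fin 2) (s : Bool) : Prop := (x = 1) ↔ (s = true)

instance (x : Fin 2) (s : Bool) : Decidable (flipsFirst x s) :=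
  inferInstanceAs (Decidable (_ ↔ _))

lemma flipsFirst_add_one (x : Fin 2) (s : Bool) : flipsFirst (x + 1) s ↔ ¬ flipsFirst x s := by
  fin_cases x <;> cases s <;> simp [flipsFirst]

lemma flipsFirst_not (x : Fin 2) (s : Bool) : flipsFirst x (!s) ↔ ¬ flipsFirst x s := by
  fin_cases x <;> cases s <;> simp [flipsFirst]

lemma toAff_letter (m : ℕ) (x : Fin 2) (s : Bool) :
    toAff m (artEval m [(x, s)]) =
      if flipsFirst x s then flip₀ m * rot m (sgn m s) else rot m (sgn m s) * flip₀ m := by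
  cases s with
  | true => fin_cases x <;> simp [toAff_letter_true, affGen, flipsFirst, sgn]
  | false =>
    rw [show false = !true from rfl, artEval_not, map_inv, toAff_letter_true]
    fin_cases x <;> simp [affGen, flipsFirst, sgn, flip₀_inv, rot_neg]

/-! ### Alternating products in the free group -/

/-- The product `y_{i₁} y_{i₂}⁻¹ y_{i₃} ⋯` with alternating exponents. -/
def altProd {m : ℕ} : List (ZMod m) → FreeGroup (ZMod m)
  | [] => 1
  | i :: l => FreeGroup.of i * twist m (1, -1) (altProd l)

/-- The word that spells an alternating product with first exponent `s`. -/
def altProdWord {m : ℕ} (s : Bool) : List (ZMod m) → List (ZMod m × Bool)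
  | [] => []
  | i :: l => (i, s) :: altProdWord (!s) l

lemma twist_mk {m : ℕ} (s : Bool) (l : List (ZMod m)) :
    twist m (1, -1) (FreeGroup.mk (altProdWord s l)) = FreeGroup.mk (altProdWord (!s) l) := by
  induction l generalizing s with
  | nil => exact map_one _
  | cons i l ih =>
    rw [altProdWord, altProdWord, ← List.singleton_append, ← FreeGroup.mul_mk, map_mul, ih,
      ← List.singleton_append (l := altProdWord _ l), ← FreeGroup.mul_mk]
    congr 1
    cases s with
    | true =>
      have h := twist_of m (1, -1) i
      simpa [FreeGroup.of, FreeGroup.inv_mk, FreeGroup.invRev] using h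
    | false =>
      have h := congrArg (·⁻¹) (twist_of m (1, -1) i)
      simpa [FreeGroup.of, FreeGroup.inv_mk, FreeGroup.invRev, ← map_inv] using h

lemma altProd_eq_mk {m : ℕ} (l : List (ZMod m)) :
    altProd l = FreeGroup.mk (altProdWord true l) := by
  induction l with
  | nil => rfl
  | cons i l ih => rw [altProd, ih, twist_mk, FreeGroup.of, FreeGroup.mul_mk]; rfl

lemma isReduced_altProdWord {m : ℕ} (s : Bool) (l : List (ZMod m)) (hl : l.IsChain (· ≠ ·)) :
    FreeGroup.IsReduced (altProdWord s l) := by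
  induction l generalizing s with
  | nil => exact .nil
  | cons i l ih =>
    cases l with
    | nil => exact .singleton
    | cons j l =>
      rw [List.isChain_cons_cons] at hl
      exact FreeGroup.isReduced_cons_cons.2 ⟨fun h => absurd h hl.1, ih _ hl.2⟩

lemma altProd_ne_one {m : ℕ} {l : List (ZMod m)} (hl : l.IsChain (· ≠ ·)) (hne : l ≠ []) :
    altProd l ≠ 1 := by
  rw [altProd_eq_mk, FreeGroup.one_eq_mk, Ne, FreeGroup.Red.exact]
  rintro ⟨w, h1, h2⟩
  rw [(isReduced_altProdWord true l hl).red_iff_eq] at h1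
  rw [FreeGroup.IsReduced.nil.red_iff_eq] at h2
  rw [h1] at h2
  cases l with
  | nil => exact hne rfl
  | cons i l => simp [altProdWord] at h2

lemma affAct_flip₀ {m : ℕ} (l : List (ZMod m)) :
    affAct (flip₀ m) (altProd l) = altProd (0 :: l) := rfl

lemma affAct_flip₀_cons {m : ℕ} (l : List (ZMod m)) :
    affAct (flip₀ m) (altProd (0 :: l)) = altProd l := by
  rw [← affAct_flip₀, ← affAct_mul, flip₀_mul_self, affAct_one]

lemma affAct_rot {m : ℕ} (i : ZMod m) (l : List (ZMod m)) :
    affAct (rot m i) (altProd l) = altProd (l.map (· + i)) := by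
  have h1 : ∀ x, affAct (rot m i) x = twist m (Multiplicative.ofAdd i, 1) x := fun x => one_mul _
  rw [h1]
  induction l with
  | nil => exact map_one _
  | cons j l ih =>
    rw [altProd, map_mul, twist_of, List.map_cons, altProd, ← ih, ← MulAut.mul_apply,
      ← MulAut.mul_apply, ← map_mul, ← map_mul, mul_comm (_, _)]
    simp

lemma isChain_map_add {m : ℕ} {l : List (ZMod m)} (i : ZMod m) (hl : l.IsChain (· ≠ ·)) :
    (l.map (· + i)).IsChain (· ≠ ·) :=
  (List.isChain_map _).2 (hl.imp fun _ _ h h' => h (add_right_cancel h'))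

lemma altProd_notMem {m : ℕ} {l : List (ZMod m)} (hl : l.IsChain (· ≠ ·)) (h1 : l ≠ [])
    (h2 : l ≠ [0]) : altProd l ∉ ({1, FreeGroup.of 0} : Set (FreeGroup (ZMod m))) := by
  have h0 : affAct (flip₀ m) (FreeGroup.of 0) = 1 := by
    simpa [altProd] using affAct_flip₀_cons (m := m) []
  rintro (h | h)
  · exact altProd_ne_one hl h1 h
  · have h' := congrArg (affAct (flip₀ m)) h
    rw [h0] at h'
    by_cases hd : ∃ l', l = 0 :: l'
    · obtain ⟨l', rfl⟩ := hd
      rw [affAct_flip₀_cons] at h'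
      exact altProd_ne_one hl.tail (by simpa using h2) h'
    · rw [affAct_flip₀] at h'
      refine altProd_ne_one ?_ (by simp) h'
      cases l with
      | nil => exact absurd rfl h1
      | cons i l => exact List.isChain_cons_cons.2 ⟨fun h => hd ⟨l, by rw [h]⟩, hl⟩

/-! ### Words without alternating subwords of length `m` -/

lemma natCast_mul_sgn_ne_zero {m n : ℕ} (h0 : 0 < n) (hn : n < m) (s : Bool) :
    (n : ZMod m) * sgn m s ≠ 0 := by
  have h : (n : ZMod m) ≠ 0 := by
    rw [Ne, ZMod.natCast_eq_zero_iff]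
    exact Nat.not_dvd_of_pos_of_lt h0 hn
  cases s <;> simpa [sgn] using h

/-- Let the word `(x, s) :: w` start with an alternating run of length `n`. It moves `1` or `y_0`,
depending on its last letter, to an alternating product whose first index is `n` or `-n` according
to the sign `s`, preceded by an index `0` if the image of the first letter starts with the
involution. The induction records the run itself, in order to conclude that it is shorter
than `m`. -/
lemma exists_affAct_eq_altProd {m : ℕ} (hm : 1 < m) (w : ArtWord) :
    ∀ (x : Fin 2) (s : Bool), FreeGroup.IsReduced ((x, s) :: w) →
      ¬ HasAltSubword m ((x, s) :: w) →
      ∃ p ∈ ({1, FreeGroup.of 0} : Set (FreeGroup (ZMod m))),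
      ∃ (n : ℕ) (l : List (ZMod m)), 0 < n ∧ n < m ∧ altSgn s x n <+: (x, s) :: w ∧
        List.IsChain (· ≠ ·) ((n : ZMod m) * sgn m s :: l) ∧
        affAct (toAff m (artEval m ((x, s) :: w))) p =
          altProd (if flipsFirst x s then 0 :: ((n : ZMod m) * sgn m s) :: l
            else ((n : ZMod m) * sgn m s) :: l) := by
  induction w with
  | nil =>
    intro x s _ _
    by_cases hf : flipsFirst x s
    · refine ⟨FreeGroup.of 0, by simp, 1, [], one_pos, hm, by simp [altSgn], by simp, ?_⟩
      have h : FreeGroup.of 0 = altProd [(0 : ZMod m)] := by simp [altProd]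
      rw [toAff_letter, if_pos hf, if_pos hf, affAct_mul, h, affAct_rot, affAct_flip₀]
      simp
    · refine ⟨1, by simp, 1, [], one_pos, hm, by simp [altSgn], by simp, ?_⟩
      have h : 1 = altProd ([] : List (ZMod m)) := rfl
      rw [toAff_letter, if_neg hf, if_neg hf, affAct_mul, h, affAct_flip₀, affAct_rot]
      simp
  | cons c w ih =>
    intro x s hr hd
    obtain ⟨y, t⟩ := c
    rw [FreeGroup.isReduced_cons_cons] at hr
    obtain ⟨p, hp, n, l, h0, hn, hpre, hl, hact⟩ := ih y t hr.2
      fun ⟨s', x', h⟩ => hd ⟨s', x', h.trans (List.suffix_cons _ _).isInfix⟩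
    refine ⟨p, hp, ?_⟩
    rw [artEval_cons, map_mul, affAct_mul, hact, toAff_letter]
    have hmap := isChain_map_add (sgn m s) hl
    by_cases hrun : y = x + 1 ∧ t = s
    · -- the letter prolongs the first alternating run
      obtain ⟨rfl, rfl⟩ := hrun
      have hpre' : altSgn t x (n + 1) <+: (x, t) :: (x + 1, t) :: w :=
        List.cons_prefix_cons.2 ⟨rfl, hpre⟩
      have hn' : n + 1 < m := by
        refine lt_of_le_of_ne hn fun h => hd ⟨t, x, ?_⟩
        rw [← h]
        exact hpre'.isInfix
      have hcast : ((n + 1 : ℕ) : ZMod m) * sgn m t = (n : ZMod m) * sgn m t + sgn m t := by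
        push_cast
        ring
      refine ⟨n + 1, l.map (· + sgn m t), n.succ_pos, hn', hpre', by rw [hcast]; exact hmap, ?_⟩
      rw [hcast]
      by_cases hf : flipsFirst x t
      · simp only [flipsFirst_add_one, hf, not_true, if_true, if_false]
        rw [affAct_mul, affAct_rot, affAct_flip₀]
        rfl
      · simp only [flipsFirst_add_one, hf, not_false_iff, if_true, if_false]
        rw [affAct_mul, affAct_flip₀_cons, affAct_rot]
        rfl
    · -- the letter starts a new run of length one
      have hf : flipsFirst y t ↔ flipsFirst x s := by
        rcases eq_or_eq_add_one x y with rfl | rfl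
        · rw [show s = t from hr.1 rfl]
        · have : t = !s := by cases t <;> cases s <;> simp_all
          rw [this, flipsFirst_not, flipsFirst_add_one, not_not]
      simp only [hf]
      refine ⟨1, ((n : ZMod m) * sgn m t :: l).map (· + sgn m s), one_pos, hm,
        by simp [altSgn], ?_, ?_⟩
      · refine List.isChain_cons_cons.2 ⟨?_, hmap⟩
        simpa using natCast_mul_sgn_ne_zero h0 hn t
      · by_cases hfx : flipsFirst x s
        · simp only [hfx, if_true]
          rw [affAct_mul, affAct_rot, affAct_flip₀]
          simp
        · simp only [hfx, if_false]
          rw [affAct_mul, affAct_flip₀, affAct_rot]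
          simp

/-- A nonempty reduced word without alternating subwords of length `m` moves the set
`{1, y_0}`. -/
lemma exists_affAct_notMem {m : ℕ} (hm : 1 < m) {w : ArtWord} (hr : FreeGroup.IsReduced w)
    (hne : w ≠ []) (hd : ¬ HasAltSubword m w) :
    ∃ p ∈ ({1, FreeGroup.of 0} : Set (FreeGroup (ZMod m))),
      affAct (toAff m (artEval m w)) p ∉ ({1, FreeGroup.of 0} : Set (FreeGroup (ZMod m))) := by
  obtain _ | ⟨⟨x, s⟩, w⟩ := w
  · exact absurd rfl hne
  obtain ⟨p, hp, n, l, h0, hn, -, hl, h⟩ := exists_affAct_eq_altProd hm w x s hr hd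
  have hz := natCast_mul_sgn_ne_zero h0 hn s
  refine ⟨p, hp, ?_⟩
  rw [h]
  split_ifs
  · exact altProd_notMem (List.isChain_cons_cons.2 ⟨hz.symm, hl⟩) (by simp) (by simp)
  · exact altProd_notMem hl (by simp) (by simpa using fun h => absurd h hz)

lemma hasAltSubword_of_artEval_eq_one {m : ℕ} (hm : 1 < m) {w : ArtWord}
    (hr : FreeGroup.IsReduced w) (hne : w ≠ []) (hw : artEval m w = 1) : HasAltSubword m w := by
  by_contra hd
  obtain ⟨p, hp, h⟩ := exists_affAct_notMem hm hr hne hd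
  rw [hw, map_one, affAct_one] at h
  exact h hp

/-! ### The center -/

/-- An element that fixes `1` and `y_0` is a power of `z`: powers of `z` preserve `{1, y_0}`, so the
reduced word that remains when they are split off does as well, and hence is empty. -/
lemma mem_zpowers_z {m : ℕ} (hm : 1 < m) {g : Art m}
    (h1 : affAct (toAff m g) 1 = 1) (h2 : affAct (toAff m g) (FreeGroup.of 0) = FreeGroup.of 0) :
    g ∈ Subgroup.zpowers (artEval m (abWord m)) := by
  obtain ⟨j, w, hr, hd, rfl⟩ := exists_zpow_mul_artEval (by omega : m ≠ 0) g
  by_cases hne : w = []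
  · subst hne
    rw [artEval_nil, mul_one]
    exact Subgroup.zpow_mem_zpowers _ _
  · exfalso
    obtain ⟨p, hp, h⟩ := exists_affAct_notMem hm hr hne hd
    apply h
    have hfix : affAct (toAff m (artEval m (abWord m) ^ j * artEval m w)) p = p := by
      rcases hp with rfl | rfl
      · exact h1
      · exact h2
    have hw : affAct (toAff m (artEval m w)) p
        = affAct (toAff m (artEval m (abWord m) ^ (-j))) p := by
      have h' := congrArg (affAct (toAff m (artEval m (abWord m) ^ (-j)))) hfix
      rwa [← affAct_mul, ← map_mul, ← mul_assoc, ← zpow_add, neg_add_cancel, zpow_zero,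
        one_mul] at h'
    rw [hw, map_zpow, toAff_z]
    have hflip : ∀ q ∈ ({1, FreeGroup.of 0} : Set (FreeGroup (ZMod m))),
        affAct (flip₀ m) q ∈ ({1, FreeGroup.of 0} : Set (FreeGroup (ZMod m))) := by
      rintro q (rfl | rfl)
      · simp [affAct, flip₀]
      · simp [affAct, flip₀, twist_of]
    split_ifs
    · rw [one_zpow, affAct_one]
      exact hp
    · rcases Int.even_or_odd (-j) with he | he
      · obtain ⟨k, hk⟩ := he
        rw [hk, ← two_mul, zpow_mul, zpow_two, flip₀_mul_self, one_zpow, affAct_one]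
        exact hp
      · obtain ⟨k, hk⟩ := he
        rw [hk, zpow_add, zpow_mul, zpow_two, flip₀_mul_self, one_zpow, one_mul, zpow_one]
        exact hflip p hp

/-- The generator of the center for `m > 2`: it is `z` or `z ^ 2` according to the parity
of `m`. -/
def centerGen (m : ℕ) : Art m :=
  if Even m then artEval m (abWord m) else artEval m (abWord m) ^ 2

lemma centerGen_mem_center (m : ℕ) : centerGen m ∈ Subgroup.center (Art m) := by
  rw [centerGen]
  split_ifs with h
  · exact z_mem_center h
  · exact z_sq_mem_center m

lemma toAff_centerGen (m : ℕ) : toAff m (centerGen m) = 1 := by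
  rw [centerGen]
  split_ifs with h
  · rw [toAff_z, if_pos h]
  · rw [map_pow, toAff_z, if_neg h, sq, flip₀_mul_self]

lemma centerGen_not_isOfFinOrder {m : ℕ} (hm : m ≠ 0) : ¬ IsOfFinOrder (centerGen m) := by
  rw [centerGen]
  split_ifs
  · exact z_not_isOfFinOrder hm
  · rw [isOfFinOrder_pow]
    simpa using z_not_isOfFinOrder hm

lemma mem_zpowers_centerGen {m : ℕ} (hm : 1 < m) {g : Art m}
    (h1 : affAct (toAff m g) 1 = 1) (h2 : affAct (toAff m g) (FreeGroup.of 0) = FreeGroup.of 0) :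
    g ∈ Subgroup.zpowers (centerGen m) := by
  have h := mem_zpowers_z hm h1 h2
  rw [centerGen]
  split_ifs with hev
  · exact h
  · obtain ⟨j, rfl⟩ := Subgroup.mem_zpowers_iff.1 h
    rcases Int.even_or_odd j with he | he
    · obtain ⟨k, rfl⟩ := he
      rw [← two_mul, zpow_mul, zpow_two, ← sq]
      exact Subgroup.zpow_mem_zpowers _ _
    · -- an odd power of `z` exchanges `1` and `y_0`
      obtain ⟨k, rfl⟩ := he
      rw [map_zpow, toAff_z, if_neg hev, zpow_add, zpow_mul, zpow_two, flip₀_mul_self, one_zpow,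
        one_mul, zpow_one] at h1
      simp [affAct, flip₀] at h1

lemma affAct_rot_eq_map {m : ℕ} (i : ZMod m) (x : FreeGroup (ZMod m)) :
    affAct (rot m i) x = FreeGroup.map (· + i) x := by
  have h : (twist m (Multiplicative.ofAdd i, 1)).toMonoidHom = FreeGroup.map (· + i) := by
    ext j
    simpa using twist_of m (Multiplicative.ofAdd i, 1) j
  exact (one_mul _).trans (DFunLike.congr_fun h x)

/-- A nontrivial rotation fixes only the empty reduced word. -/
lemma eq_one_of_affAct_rot {m : ℕ} {i : ZMod m} (hi : i ≠ 0) {x : FreeGroup (ZMod m)}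
    (hx : affAct (rot m i) x = x) : x = 1 := by
  rw [affAct_rot_eq_map] at hx
  obtain ⟨w, hw, rfl⟩ : ∃ w, FreeGroup.IsReduced w ∧ FreeGroup.mk w = x :=
    ⟨x.toWord, FreeGroup.isReduced_toWord, FreeGroup.mk_toWord⟩
  have hw' : FreeGroup.IsReduced (w.map fun c => (c.1 + i, c.2)) :=
    (List.isChain_map _).2 (hw.imp fun _ _ h h' => h (add_right_cancel h'))
  rw [FreeGroup.map.mk, FreeGroup.Red.exact] at hx
  obtain ⟨v, hv1, hv2⟩ := hx
  rw [hw'.red_iff_eq] at hv1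
  rw [hw.red_iff_eq] at hv2
  rw [hv1] at hv2
  cases w with
  | nil => rfl
  | cons c w =>
    have := congrArg Prod.fst (List.cons.inj hv2).1
    exact absurd (by simpa using this) hi

/-- A central element commutes with the images `τ ^ 2` of `ab` and `δ τ ^ 2 δ` of `ba`, each of
which has only one fixed point in the free group; hence it fixes `1` and `y_0`. -/
lemma center_le_zpowers_centerGen {m : ℕ} (hm : 2 < m) :
    Subgroup.center (Art m) ≤ Subgroup.zpowers (centerGen m) := by
  intro g hg
  rw [Subgroup.mem_center_iff] at hg
  have h2 : (1 + 1 : ZMod m) ≠ 0 := by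
    have h : ((2 : ℕ) : ZMod m) ≠ 0 := by
      rw [Ne, ZMod.natCast_eq_zero_iff]
      exact Nat.not_dvd_of_pos_of_lt two_pos hm
    simpa [one_add_one_eq_two] using h
  have hcomm : ∀ w : ArtWord, toAff m (artEval m w) * toAff m g
      = toAff m g * toAff m (artEval m w) := fun w => by rw [← map_mul, hg, map_mul]
  have hab : toAff m (artEval m [(0, true), (1, true)]) = rot m (1 + 1) := by
    rw [artEval_cons, map_mul, toAff_letter_true, toAff_letter_true]
    simp [affGen, mul_assoc, flip₀_mul_flip₀_mul, rot_add]
  have hba : toAff m (artEval m [(1, true), (0, true)]) = flip₀ m * rot m (1 + 1) * flip₀ m := by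
    rw [artEval_cons, map_mul, toAff_letter_true, toAff_letter_true]
    simp [affGen, mul_assoc, rot_add]
  have hy : affAct (flip₀ m) 1 = FreeGroup.of 0 := by simp [affAct, flip₀]
  have hy' : affAct (flip₀ m) (FreeGroup.of 0) = 1 := by
    rw [← hy, ← affAct_mul, flip₀_mul_self, affAct_one]
  have hone : affAct (rot m (1 + 1)) 1 = 1 := by simp [affAct_rot_eq_map]
  refine mem_zpowers_centerGen (by omega) ?_ ?_
  · apply eq_one_of_affAct_rot h2
    rw [← affAct_mul, ← hab, hcomm, affAct_mul, hab, hone]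
  · have h : affAct (flip₀ m) (affAct (toAff m g) (FreeGroup.of 0)) = 1 := by
      apply eq_one_of_affAct_rot h2
      rw [← affAct_mul, ← affAct_mul]
      have h' := hcomm [(1, true), (0, true)]
      rw [hba] at h'
      have h'' : rot m (1 + 1) * flip₀ m * toAff m g
          = flip₀ m * (toAff m g * (flip₀ m * rot m (1 + 1) * flip₀ m)) := by
        rw [← h']
        simp only [mul_assoc, flip₀_mul_flip₀_mul]
      rw [h'']
      simp only [affAct_mul, hy', hone, hy]
    rw [← affAct_one (affAct (toAff m g) _), ← flip₀_mul_self, affAct_mul, h, hy]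

lemma center_eq_zpowers_centerGen {m : ℕ} (hm : 2 < m) :
    Subgroup.center (Art m) = Subgroup.zpowers (centerGen m) :=
  le_antisymm (center_le_zpowers_centerGen hm)
    (Subgroup.zpowers_le.2 (centerGen_mem_center m))

/-! ### A finite-index subgroup -/

/-- An extension of a free group by a central infinite cyclic group splits as a direct product. -/
lemma nonempty_mulEquiv_freeGroup_prod {H F : Type} [Group H] [Group F] [IsFreeGroup F]
    (f : H →* F) (c : H) (hc : c ∈ Subgroup.center H) (hinf : ¬ IsOfFinOrder c)
    (hker : f.ker = Subgroup.zpowers c) :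
    ∃ α : Type, Nonempty (H ≃* FreeGroup α × Multiplicative ℤ) := by
  let e := IsFreeGroup.toFreeGroup f.range
  refine ⟨IsFreeGroup.Generators f.range, ?_⟩
  have hs : ∀ y : f.range, ∃ h : H, f.rangeRestrict h = y := f.rangeRestrict_surjective
  choose r hr using hs
  let s : FreeGroup (IsFreeGroup.Generators f.range) →* H :=
    FreeGroup.lift fun i => r (e.symm (FreeGroup.of i))
  have hfs : ∀ w, f.rangeRestrict (s w) = e.symm w := by
    intro w
    have h : (f.rangeRestrict).comp s = e.symm.toMonoidHom := by
      ext i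
      simp [s, hr]
    exact DFunLike.congr_fun h w
  have hcomm : ∀ w n, Commute (s w) (zpowersHom H c n) := fun w n => by
    rw [zpowersHom_apply]
    exact (Subgroup.mem_center_iff.1 (Subgroup.zpow_mem _ hc _) (s w))
  have hfc : ∀ n, f.rangeRestrict (zpowersHom H c n) = 1 := fun n => by
    rw [← MonoidHom.mem_ker, MonoidHom.ker_rangeRestrict, hker, zpowersHom_apply]
    exact Subgroup.zpow_mem_zpowers _ _
  refine ⟨(MulEquiv.ofBijective (MonoidHom.noncommCoprod s (zpowersHom H c) hcomm) ⟨?_, ?_⟩).symm⟩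
  · rw [injective_iff_map_eq_one]
    rintro ⟨w, n⟩ h
    rw [MonoidHom.noncommCoprod_apply] at h
    have h1 := congrArg f.rangeRestrict h
    rw [map_mul, hfs, hfc, mul_one, map_one, EmbeddingLike.map_eq_one_iff] at h1
    simp only at h1
    subst h1
    rw [map_one, one_mul, zpowersHom_apply] at h
    have hn : n.toAdd = 0 := by
      by_contra hn
      exact hinf (isOfFinOrder_iff_zpow_eq_one.2 ⟨_, hn, h⟩)
    exact Prod.ext rfl (by simpa using hn)
  · intro h
    have hmem : (s (e (f.rangeRestrict h)))⁻¹ * h ∈ f.ker := by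
      rw [← MonoidHom.ker_rangeRestrict, MonoidHom.mem_ker, map_mul, map_inv, hfs]
      simp
    rw [hker, Subgroup.mem_zpowers_iff] at hmem
    obtain ⟨n, hn⟩ := hmem
    refine ⟨(e (f.rangeRestrict h), Multiplicative.ofAdd n), ?_⟩
    rw [MonoidHom.noncommCoprod_apply, zpowersHom_apply]
    simp only [toAdd_ofAdd, hn]
    rw [mul_inv_cancel_left]

/-- The elements that act by left translations of the free group. -/
def translationSubgroup (m : ℕ) : Subgroup (Art m) :=
  (SemidirectProduct.rightHom.comp (toAff m)).ker

/-- The translation part of the elements of the translation subgroup. -/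
def translationHom (m : ℕ) : translationSubgroup m →* FreeGroup (ZMod m) where
  toFun g := (toAff m g).left
  map_one' := by simp
  map_mul' g h := by
    have hg : (toAff m g).right = 1 := g.2
    simp [hg]

lemma virtually_free_prod_cyclic {m : ℕ} (hm : 1 < m) :
    ∃ H : Subgroup (Art m), H.FiniteIndex ∧
      ∃ α : Type, Nonempty (H ≃* FreeGroup α × Multiplicative ℤ) := by
  have : NeZero m := ⟨by omega⟩
  have : Finite (TwistGroup m) := inferInstanceAs (Finite (ZMod m × ℤˣ))
  have hmem : centerGen m ∈ translationSubgroup m := by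
    simp [translationSubgroup, MonoidHom.mem_ker, toAff_centerGen]
  refine ⟨translationSubgroup m, Subgroup.finiteIndex_ker _,
    nonempty_mulEquiv_freeGroup_prod (translationHom m) ⟨centerGen m, hmem⟩ ?_ ?_ ?_⟩
  · rw [Subgroup.mem_center_iff]
    intro g
    exact Subtype.ext (Subgroup.mem_center_iff.1 (centerGen_mem_center m) g)
  · rw [← Submonoid.isOfFinOrder_coe]
    exact centerGen_not_isOfFinOrder (by omega)
  · ext ⟨g, hg⟩
    have hr : (toAff m g).right = 1 := hg
    constructor
    · intro h
      have hl : (toAff m g).left = 1 := h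
      obtain ⟨j, hj⟩ := Subgroup.mem_zpowers_iff.1
        (mem_zpowers_centerGen hm (g := g) (by simp [affAct, hl, hr]) (by simp [affAct, hl, hr]))
      exact Subgroup.mem_zpowers_iff.2 ⟨j, Subtype.ext hj⟩
    · intro h
      obtain ⟨j, hj⟩ := Subgroup.mem_zpowers_iff.1 h
      have hj' : centerGen m ^ j = g := congrArg Subtype.val hj
      change (toAff m g).left = 1
      rw [← hj', map_zpow, toAff_centerGen, one_zpow, SemidirectProduct.one_left]

theorem mainTheorem5 (m : ℕ) (hm : 1 < m) (z : Art m) (hz : z = artEval m (abWord m)) :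
    -- (1) the center; for `m = 2` the group is abelian
    ((2 < m → Even m →
        Subgroup.center (Art m) = Subgroup.zpowers z ∧ ¬ IsOfFinOrder z) ∧
      (2 < m → Odd m →
        Subgroup.center (Art m) = Subgroup.zpowers (z ^ 2) ∧ ¬ IsOfFinOrder (z ^ 2)) ∧
      (m = 2 → Subgroup.center (Art m) = ⊤ ∧ ¬ IsOfFinOrder z)) ∧
    -- (2) virtually free times infinite cyclic
    (∃ H : Subgroup (Art m), H.FiniteIndex ∧
      ∃ α : Type, Nonempty (H ≃* FreeGroup α × Multiplicative ℤ)) ∧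
    -- (3) subwords of nontrivial reduced words that represent the identity
    (∀ w : ArtWord, FreeGroup.IsReduced w → w ≠ [] → artEval m w = 1 →
      abWord m <:+: w ∨ baWord m <:+: w ∨
        FreeGroup.invRev (abWord m) <:+: w ∨ FreeGroup.invRev (baWord m) <:+: w) ∧
    -- (4) the word problem
    (∀ w : ArtWord, artEval m w = 1 ↔ Relation.ReflTransGen (ArtMove m) w []) := by
  subst hz
  have hm0 : m ≠ 0 := by omega
  refine ⟨⟨fun h2 he => ?_, fun h2 ho => ?_, fun h2 => ?_⟩, virtually_free_prod_cyclic hm,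
    fun w hr hne hw => (hasAltSubword_of_artEval_eq_one hm hr hne hw).cases,
    fun w => ⟨fun hw => reflTransGen_nil_of_artEval_eq_one hm0
      (fun w hr hne hw => hasAltSubword_of_artEval_eq_one hm hr hne hw) w hw,
      artEval_eq_of_reflTransGen⟩⟩
  · have h := centerGen_not_isOfFinOrder hm0
    rw [center_eq_zpowers_centerGen h2]
    rw [centerGen, if_pos he] at *
    exact ⟨rfl, h⟩
  · have h := centerGen_not_isOfFinOrder hm0
    rw [center_eq_zpowers_centerGen h2]
    rw [centerGen, if_neg (Nat.not_even_iff_odd.2 ho)] at *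
    exact ⟨rfl, h⟩
  · subst h2
    exact ⟨center_eq_top, z_not_isOfFinOrder hm0⟩
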